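/- Let $H$ be a real separable Hilbert space, let $\mu$ be a Borel probability measure on $H$ with bounded support, and let $d\ge 0$ be an integer with $d\le\dim H$ (where $\dim H\le\infty$). A $d$-flat is a $d$-dimensional affine subspace of $H$; let $\mathrm{AG}_d(H)$ be the set of all $d$-flats, and put $$e_2(\mu,d)=\inf_{L\in \mathrm{AG}_d(H)}\Big(\int \operatorname{dist}^2(x,L)\,d\mu(x)\Big)^{1/2}.$$ A least squares (LS) $d$-flat for $\mu$ is a $d$-flat at which this infimum is attained. Let $x_{\mathrm{cm}}=\int x\,d\mu(x)$ be the center of mass of $\mu$, and let $A_\mu:H\to L_2(\mu)$, $(A_\mu y)(x)=\langle y,x-x_{\mathrm{cm}}\rangle$, be the data-to-features operator. Let $\sigma_1\ge\sigma_2\ge\cdots\ge 0$ be the singular values of $A_\mu$, i.e. the square roots of the eigenvalues of $A_\mu^*A_\mu$, repeated according to multiplicity, with $\sigma_i=0$ for $i>\dim H$. Vectors $v_1,\dots,v_d\in H$ are called top right singular vectors of $A_\mu$ if they are orthonormal and $A_\mu^*A_\mu v_i=\sigma_i^2v_i$ for $1\le i\le d$. Then: 1. An LS $d$-flat for $\mu$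 exists. Top right singular vectors $v_1,\dots,v_d$ of $A_\mu$ exist, and for every choice of them $x_{\mathrm{cm}}+\operatorname{Sp}\{v_1,\dots,v_d\}$ is an LS $d$-flat for $\mu$. 2. If $1\le d<\dim H$, then the LS $d$-flat is unique if and only if $\sigma_d>\sigma_{d+1}$. If $d=0$ or $d=\dim H$, it is always unique. 3. $\sum_{i>d}\sigma_i^2<\infty$ and $e_2(\mu,d)=\big(\sum_{i>d}\sigma_i^2\big)^{1/2}$. -/

import Mathlib

open MeasureTheory

noncomputable section

namespace LeastSquaresFlats

section Flats

variable {H : Type*} [NormedAddCommGroup H] [InnerProductSpace ℝ H]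

/-- The affine Grassmannian `AG_d(H)`: the set of all `d`-flats, that is, of all (nonempty) affine
subspaces of `H` of dimension `d`. The dimension is a cardinal, so that infinite-dimensional
subspaces are not counted as zero-dimensional. -/
def affineGrassmannian (H : Type*) [NormedAddCommGroup H] [InnerProductSpace ℝ H] (d : ℕ) :
    Set (AffineSubspace ℝ H) :=
  {L | (L : Set H).Nonempty ∧ Module.rank ℝ L.direction = (d : Cardinal)}

variable [MeasurableSpace H]

/-- The root mean square distance `(∫ dist(x, L)² dμ(x))^{1/2}` of `μ` to `L`. -/
def rmsDist (μ : Measure H) (L : AffineSubspace ℝ H) : ℝ :=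
  √(∫ x, Metric.infDist x (L : Set H) ^ 2 ∂μ)

/-- The `d`-dimensional least squares error `e₂(μ, d)`. -/
def lsError (μ : Measure H) (d : ℕ) : ℝ :=
  ⨅ L : affineGrassmannian H d, rmsDist μ (L : AffineSubspace ℝ H)

/-- `L` is a least squares `d`-flat for `μ`: a `d`-flat at which the root mean square distance
attains its minimum over all `d`-flats. -/
def IsLSFlat (μ : Measure H) (d : ℕ) (L : AffineSubspace ℝ H) : Prop :=
  L ∈ affineGrassmannian H d ∧ IsMinOn (rmsDist μ) (affineGrassmannian H d) L

/-- The center of mass `∫ x dμ(x)`. -/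
def centerOfMass (μ : Measure H) : H := ∫ x, x ∂μ

end Flats

section DataToFeatures

variable {H : Type*} [NormedAddCommGroup H] [InnerProductSpace ℝ H]
  [TopologicalSpace.SeparableSpace H] [MeasurableSpace H] [BorelSpace H]

/-- The centered data `x ↦ x - x_cm` is square integrable if `μ` has bounded support. -/
theorem memLp_sub_centerOfMass (μ : Measure H) [IsProbabilityMeasure μ]
    (hμ : Bornology.IsBounded μ.support) :
    MemLp (fun x : H => x - centerOfMass μ) 2 μ := by
  have : SecondCountableTopology H := UniformSpace.secondCountable_of_separable H
  obtain ⟨C, hC⟩ := hμ.exists_norm_le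
  have hid : MemLp (fun x : H => x) 2 μ := by
    refine MemLp.of_bound measurable_id.aestronglyMeasurable C ?_
    filter_upwards [Measure.support_mem_ae (μ := μ)] with x hx
    exact hC x hx
  exact hid.sub (memLp_const _)

/-- The data-to-features operator `A_μ : H → L²(μ)`, `(A_μ y)(x) = ⟪y, x - x_cm⟫`. -/
def dataToFeatures (μ : Measure H) [IsProbabilityMeasure μ]
    (hμ : Bornology.IsBounded μ.support) : H →L[ℝ] Lp ℝ 2 μ :=
  LinearMap.mkContinuous
    { toFun := fun y => (innerSL ℝ y).compLp ((memLp_sub_centerOfMass μ hμ).toLp _)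
      map_add' := fun y z => by rw [map_add, ContinuousLinearMap.add_compLp]
      map_smul' := fun c y => by
        rw [map_smul, ContinuousLinearMap.smul_compLp, RingHom.id_apply] }
    ‖(memLp_sub_centerOfMass μ hμ).toLp _‖
    (fun y => by
      have h := (innerSL ℝ y).norm_compLp_le ((memLp_sub_centerOfMass μ hμ).toLp _)
      rw [innerSL_apply_norm, mul_comm] at h
      exact h)

theorem dataToFeatures_ae (μ : Measure H) [IsProbabilityMeasure μ]
    (hμ : Bornology.IsBounded μ.support) (y : H) :
    dataToFeatures μ hμ y =ᵐ[μ] fun x => inner ℝ y (x - centerOfMass μ) := by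
  have h1 := (innerSL ℝ y).coeFn_compLp ((memLp_sub_centerOfMass μ hμ).toLp _)
  filter_upwards [h1, (memLp_sub_centerOfMass μ hμ).coeFn_toLp] with x hx hx'
  change ((innerSL ℝ y).compLp ((memLp_sub_centerOfMass μ hμ).toLp _)) x = _
  rw [hx, hx']
  rfl

end DataToFeatures

section SingularValues

variable {H F : Type*} [NormedAddCommGroup H] [InnerProductSpace ℝ H] [CompleteSpace H]
  [NormedAddCommGroup F] [InnerProductSpace ℝ F] [CompleteSpace F]

/-- The eigenspace of `A* A` for the eigenvalue `s ^ 2`; it consists of the right singular vectors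
of `A` for the singular value `s ≥ 0` (and of the zero vector). -/
def rightSingularSpace (A : H →L[ℝ] F) (s : ℝ) : Submodule ℝ H :=
  Module.End.eigenspace (((ContinuousLinearMap.adjoint A).comp A : H →L[ℝ] H) : H →ₗ[ℝ] H) (s ^ 2)

/-- The singular values of a compact operator `A`, in decreasing order, repeated according to
multiplicity, and numbered from zero (`singularValue A n` is `σ_{n+1}`): the largest `s ≥ 0` such
that the singular values `≥ s` of `A` have total multiplicity at least `n + 1`. The values beyond
the dimension of `H` are zero. -/
def singularValue (A : H →L[ℝ] F) (n : ℕ) : ℝ :=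
  sSup {s : ℝ | 0 ≤ s ∧
    (n : Cardinal) < Module.rank ℝ (⨆ t ∈ Set.Ici s, rightSingularSpace A t : Submodule ℝ H)}

/-- `v₁, …, v_d` are top right singular vectors of `A`: orthonormal eigenvectors of `A* A` for the
`d` largest eigenvalues `σ₁², …, σ_d²`, counted with multiplicity. -/
def IsTopRightSingularVectors (A : H →L[ℝ] F) {d : ℕ} (v : Fin d → H) : Prop :=
  Orthonormal ℝ v ∧ ∀ i : Fin d,
    (ContinuousLinearMap.adjoint A) (A (v i)) = (singularValue A (i : ℕ) ^ 2) • v i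

end SingularValues

end LeastSquaresFlats

end

open LeastSquaresFlats

/-! Write `A` for the data-to-features operator, `c` for the center of mass and `V` for the total
variance. If `u₁, …, u_d` is an orthonormal basis of the direction of a flat `L`, then Pythagoras
and the vanishing of the first moment about `c` give `∫ dist²(x, L) dμ = V - ∑ ‖A u_j‖² + dist²(c,
L)` (`integral_infDist_sq`). Least squares flats are therefore those that pass through `c` and whose
direction maximizes `∑ ‖A u_j‖²`.

Ky Fan's inequality (`sum_norm_sq_apply_le_sum_singularValue_sq`) bounds this sum by `σ₁² + ⋯ +
σ_d²`, and any top right singular vectors attain the bound. At a spectral gap, equality determines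
the span (`IsTopRightSingularVectors.span_eq_of_sum_norm_sq_eq`); without a gap, exchanging one
singular vector gives a second minimizer. Since `V = ∑ σ_i²` (`hasSum_singularValue_sq`), the
minimum is the tail of this series.

The singular vectors come from the spectral theory of compact operators. `A` is compact because its
kernel is square integrable (`isCompactOperator_innerLp`), and `exists_isTopRightSingularVectors`
splits off one norm-attaining eigenvector of `A* A` at a time. -/

namespace LeastSquaresFlats

open ContinuousLinearMap (adjoint)

/-! ### Finite orthonormal families and their spans. -/

section Orthonormal

variable {H : Type*} [NormedAddCommGroup H] [InnerProductSpace ℝ H]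

theorem inner_sub_sum_inner_smul {n : ℕ} {v : Fin n → H} (hv : Orthonormal ℝ v) (y : H)
    (i : Fin n) : inner ℝ (v i) (y - ∑ j, inner ℝ (v j) y • v j) = 0 := by
  rw [inner_sub_right, hv.inner_right_fintype, sub_self]

theorem orthonormal_snoc {n : ℕ} {v : Fin n → H} (hv : Orthonormal ℝ v) {u : H} (hu : ‖u‖ = 1)
    (hvu : ∀ i, inner ℝ (v i) u = 0) : Orthonormal ℝ (Fin.snoc v u : Fin (n + 1) → H) := by
  rw [orthonormal_iff_ite] at hv ⊢
  intro i j
  induction i using Fin.lastCases with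
  | last =>
    induction j using Fin.lastCases with
    | last => simp [hu]
    | cast j =>
      have := (Fin.castSucc_lt_last j).ne'
      simp [this, real_inner_comm (v j) u, hvu j]
  | cast i =>
    induction j using Fin.lastCases with
    | last => simp [hvu i]
    | cast j => simp [hv i j]

theorem mem_orthogonal_span_range {ι : Type*} {v : ι → H} {y : H} :
    y ∈ (Submodule.span ℝ (Set.range v))ᗮ ↔ ∀ i, inner ℝ (v i) y = 0 := by
  rw [Submodule.mem_orthogonal]
  refine ⟨fun h i => h _ (Submodule.subset_span (Set.mem_range_self i)), fun h x hx => ?_⟩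
  induction hx using Submodule.span_induction with
  | mem x hx => obtain ⟨i, rfl⟩ := hx; exact h i
  | zero => exact inner_zero_left _
  | add x y _ _ hx hy => rw [inner_add_left, hx, hy, add_zero]
  | smul c x _ hx => rw [real_inner_smul_left, hx, mul_zero]

theorem rank_span_range_fin_le {n : ℕ} (v : Fin n → H) :
    Module.rank ℝ (Submodule.span ℝ (Set.range v)) ≤ n := by
  have : FiniteDimensional ℝ (Submodule.span ℝ (Set.range v)) :=
    FiniteDimensional.span_of_finite ℝ (Set.finite_range v)
  rw [← Module.finrank_eq_rank, Nat.cast_le]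
  exact (finrank_range_le_card (R := ℝ) v).trans_eq (Fintype.card_fin n)

theorem natCast_le_rank_of_linearIndependent {n : ℕ} {v : Fin n → H}
    (hv : LinearIndependent ℝ v) : (n : Cardinal) ≤ Module.rank ℝ H := by
  simpa using hv.cardinal_lift_le_rank

end Orthonormal

/-! ### Singular values and right singular vectors of compact operators. -/

section CompactOperators

variable {H F : Type*} [NormedAddCommGroup H] [InnerProductSpace ℝ H] [CompleteSpace H]
  [NormedAddCommGroup F] [InnerProductSpace ℝ F] [CompleteSpace F]

theorem inner_adjoint_apply_self (A : H →L[ℝ] F) (x : H) :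
    inner ℝ (adjoint A (A x)) x = ‖A x‖ ^ 2 := by
  rw [ContinuousLinearMap.adjoint_inner_left, real_inner_self_eq_norm_sq]

theorem inner_adjoint_comm (A : H →L[ℝ] F) (x y : H) :
    inner ℝ (adjoint A (A x)) y = inner ℝ x (adjoint A (A y)) := by
  rw [ContinuousLinearMap.adjoint_inner_left, ContinuousLinearMap.adjoint_inner_right]

/-- A compact operator on a nontrivial Hilbert space has a right singular vector for its norm. -/
theorem exists_rightSingularVector_norm [Nontrivial H] (A : H →L[ℝ] F)
    (hA : IsCompactOperator A) :
    ∃ u : H, ‖u‖ = 1 ∧ adjoint A (A u) = ‖A‖ ^ 2 • u := by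
  set T : H →L[ℝ] H := (adjoint A).comp A with hT
  have hTn : ‖T‖ = ‖A‖ ^ 2 := by
    rw [hT, ContinuousLinearMap.norm_adjoint_comp_self, sq]
  by_cases h0 : T = 0
  · obtain ⟨u, hu⟩ := exists_norm_eq H (zero_le_one (α := ℝ))
    refine ⟨u, hu, ?_⟩
    have : adjoint A (A u) = T u := rfl
    rw [this, ← hTn, h0]
    simp
  have hTc : IsCompactOperator T := hA.clm_comp (adjoint A)
  have hsa : IsSelfAdjoint T := ContinuousLinearMap.IsPositive.isSelfAdjoint
    (ContinuousLinearMap.isPositive_adjoint_comp_self A)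
  have hr := ContinuousLinearMap.spectralRadius_eq_nnnorm T hsa
  -- Over `ℝ` a spectrum may be empty. Here that would make the spectral radius `0`, while
  -- self-adjointness makes it `‖T‖ ≠ 0`.
  have hne : (spectrum ℝ T).Nonempty := by
    by_contra hemp
    rw [Set.not_nonempty_iff_eq_empty] at hemp
    rw [spectralRadius, hemp] at hr
    simp at hr
    exact h0 (nnnorm_eq_zero.1 hr.symm)
  obtain ⟨k, hk, hk'⟩ := spectrum.exists_nnnorm_eq_spectralRadius_of_nonempty hne
  rw [hr, ENNReal.coe_inj] at hk'
  have hk'' : ‖k‖ = ‖T‖ := congrArg NNReal.toReal hk'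
  have hk0 : k ≠ 0 := by
    rintro rfl
    rw [norm_zero] at hk''
    exact h0 (norm_eq_zero.1 hk''.symm)
  have hev := (IsCompactOperator.hasEigenvalue_iff_mem_spectrum hTc hk0).2 hk
  obtain ⟨w, hw⟩ := hev.exists_hasEigenvector
  have hw0 : ‖w‖ ≠ 0 := norm_ne_zero_iff.2 hw.2
  have hTw : adjoint A (A w) = k • w := hw.apply_eq_smul
  -- So far only `|k| = ‖T‖` is known; positivity of `A* A` excludes `k = -‖T‖`.
  have hkpos : 0 ≤ k := by
    have h1 := inner_adjoint_apply_self A w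
    rw [hTw, real_inner_smul_left, real_inner_self_eq_norm_sq] at h1
    by_contra hneg
    have : 0 < ‖w‖ ^ 2 := by positivity
    nlinarith [sq_nonneg ‖A w‖]
  rw [Real.norm_of_nonneg hkpos, hTn] at hk''
  refine ⟨‖w‖⁻¹ • w, ?_, ?_⟩
  · rw [norm_smul, norm_inv, norm_norm, inv_mul_cancel₀ hw0]
  · rw [map_smul, map_smul, hTw, hk'', smul_comm]

/-- A compact operator attains its norm on a nontrivial closed subspace that is invariant under
`A* A`, and does so at a right singular vector. -/
theorem exists_rightSingularVector_mem (A : H →L[ℝ] F) (hA : IsCompactOperator A)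
    (K : Submodule ℝ H) [CompleteSpace K] [Nontrivial K]
    (hK : ∀ y ∈ K, adjoint A (A y) ∈ K) :
    ∃ u ∈ K, ‖u‖ = 1 ∧ adjoint A (A u) = ‖A u‖ ^ 2 • u ∧ ∀ y ∈ K, ‖A y‖ ≤ ‖A u‖ * ‖y‖ := by
  set B : K →L[ℝ] F := A.comp K.subtypeL with hB
  obtain ⟨u, hu, hBu⟩ := exists_rightSingularVector_norm B (hA.comp_clm K.subtypeL)
  have hsq : ‖A u‖ ^ 2 = ‖B‖ ^ 2 := by
    have h1 := inner_adjoint_apply_self B u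
    rw [hBu, real_inner_smul_left, real_inner_self_eq_norm_sq, hu] at h1
    have : B u = A u := rfl
    rw [← this, ← h1]
    ring
  have hn : ‖A u‖ = ‖B‖ := by
    rw [← abs_of_nonneg (norm_nonneg (A u)), ← abs_of_nonneg (norm_nonneg B)]
    exact (sq_eq_sq_iff_abs_eq_abs _ _).1 hsq
  refine ⟨u, u.2, hu, ?_, fun y hy => ?_⟩
  -- The eigenvector equation for `B` only says that this defect is orthogonal to `K`. By invariance
  -- the defect lies in `K`, so it is orthogonal to itself.
  · have hz : adjoint A (A u) - ‖A u‖ ^ 2 • (u : H) ∈ K :=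
      K.sub_mem (hK _ u.2) (K.smul_mem _ u.2)
    rw [← sub_eq_zero, ← inner_self_eq_zero (𝕜 := ℝ)]
    set z : K := ⟨_, hz⟩ with hzdef
    have h1 : inner ℝ (adjoint B (B u) - ‖B‖ ^ 2 • u) z = 0 := by
      rw [hBu, sub_self, inner_zero_left]
    rw [inner_sub_left, real_inner_smul_left, ContinuousLinearMap.adjoint_inner_left] at h1
    change inner ℝ (adjoint A (A u) - ‖A u‖ ^ 2 • (u : H)) (z : H) = 0
    rw [inner_sub_left, real_inner_smul_left, ContinuousLinearMap.adjoint_inner_left, hsq]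
    exact h1
  · rw [hn]
    exact B.le_opNorm ⟨y, hy⟩

theorem mem_rightSingularSpace {A : H →L[ℝ] F} {s : ℝ} {x : H} :
    x ∈ rightSingularSpace A s ↔ adjoint A (A x) = s ^ 2 • x :=
  Module.End.mem_eigenspace_iff

theorem norm_apply_of_mem_rightSingularSpace {A : H →L[ℝ] F} {s : ℝ} (hs : 0 ≤ s) {x : H}
    (hx : x ∈ rightSingularSpace A s) : ‖A x‖ = s * ‖x‖ := by
  have h := inner_adjoint_apply_self A x
  rw [mem_rightSingularSpace.1 hx, real_inner_smul_left, real_inner_self_eq_norm_sq,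
    ← mul_pow] at h
  exact ((pow_left_inj₀ (by positivity) (norm_nonneg _) two_ne_zero).1 h).symm

/-- The set of which the singular value `singularValue A n` is the supremum. -/
def singularLevels (A : H →L[ℝ] F) (n : ℕ) : Set ℝ :=
  {s : ℝ | 0 ≤ s ∧
    (n : Cardinal) < Module.rank ℝ (⨆ t ∈ Set.Ici s, rightSingularSpace A t : Submodule ℝ H)}

theorem singularValue_nonneg (A : H →L[ℝ] F) (n : ℕ) : 0 ≤ singularValue A n :=
  Real.sSup_nonneg fun _ hs => hs.1

/-- For `t > ‖A‖` the eigenspaces vanish, since `‖A x‖ = t ‖x‖` on them. Boundedness is essential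
because `sSup` of an unbounded set of reals is `0`. -/
theorem bddAbove_singularLevels (A : H →L[ℝ] F) (n : ℕ) : BddAbove (singularLevels A n) := by
  refine ⟨‖A‖, fun s ⟨hs, hrank⟩ => ?_⟩
  by_contra! hlt
  have : (⨆ t ∈ Set.Ici s, rightSingularSpace A t : Submodule ℝ H) = ⊥ := by
    refine iSup₂_eq_bot.2 fun t ht => (Submodule.eq_bot_iff _).2 fun x hx => ?_
    by_contra hx0
    have hst : s ≤ t := ht
    have h1 := norm_apply_of_mem_rightSingularSpace (hs.trans hst) hx
    have h2 := A.le_opNorm x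
    rw [h1] at h2
    exact absurd (le_of_mul_le_mul_right h2 (norm_pos_iff.2 hx0)) (not_le.2 (hlt.trans_le hst))
  rw [this, rank_bot] at hrank
  exact absurd hrank (not_lt.2 zero_le)

theorem singularValue_antitone (A : H →L[ℝ] F) : Antitone (singularValue A) := by
  refine antitone_nat_of_succ_le fun n => ?_
  refine Real.sSup_le (fun s hs => le_csSup (bddAbove_singularLevels A n) ⟨hs.1, ?_⟩)
    (singularValue_nonneg A n)
  exact lt_of_le_of_lt (by exact_mod_cast n.le_succ) hs.2

/-- The singular values beyond the dimension vanish. -/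
theorem singularValue_eq_zero_of_rank_le (A : H →L[ℝ] F) {n : ℕ}
    (hn : Module.rank ℝ H ≤ n) : singularValue A n = 0 := by
  refine le_antisymm (Real.sSup_le (fun s hs => ?_) le_rfl) (singularValue_nonneg A n)
  exact absurd (hs.2.trans_le (Submodule.rank_le _)) (not_lt.2 hn)

/-- `singularValue A n` in terms of `n` orthonormal right singular vectors that dominate the
orthogonal complement of their span. -/
theorem singularValue_eq_of_forall_le {A : H →L[ℝ] F} {n : ℕ} {v : Fin n → H}
    (hv : Orthonormal ℝ v) {s : Fin n → ℝ}
    (hvs : ∀ i, adjoint A (A (v i)) = s i ^ 2 • v i) {u : H} (hu : ‖u‖ = 1)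
    (hvu : ∀ i, inner ℝ (v i) u = 0) (hAu : adjoint A (A u) = ‖A u‖ ^ 2 • u)
    (hus : ∀ i, ‖A u‖ ≤ s i)
    (hmax : ∀ y, (∀ i, inner ℝ (v i) y = 0) → ‖A y‖ ≤ ‖A u‖ * ‖y‖) :
    singularValue A n = ‖A u‖ := by
  have hmem : ‖A u‖ ∈ singularLevels A n := by
    refine ⟨norm_nonneg _, ?_⟩
    have ho := orthonormal_snoc hv hu hvu
    set W := (⨆ t ∈ Set.Ici ‖A u‖, rightSingularSpace A t : Submodule ℝ H)
    have hW : ∀ i, (Fin.snoc v u : Fin (n + 1) → H) i ∈ W := by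
      intro i
      induction i using Fin.lastCases with
      | last =>
        rw [Fin.snoc_last]
        exact Submodule.mem_iSup_of_mem _ (Submodule.mem_iSup_of_mem (Set.self_mem_Ici)
          (mem_rightSingularSpace.2 hAu))
      | cast i =>
        rw [Fin.snoc_castSucc]
        exact Submodule.mem_iSup_of_mem (s i) (Submodule.mem_iSup_of_mem (hus i)
          (mem_rightSingularSpace.2 (hvs i)))
    have hli : LinearIndependent ℝ (fun i => (⟨_, hW i⟩ : W)) :=
      LinearIndependent.of_comp W.subtype ho.linearIndependent
    exact lt_of_lt_of_le (by exact_mod_cast n.lt_succ_self)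
      (natCast_le_rank_of_linearIndependent hli)
  refine le_antisymm (csSup_le ⟨_, hmem⟩ ?_) (le_csSup (bddAbove_singularLevels A n) hmem)
  rintro r ⟨hr0, hr⟩
  by_contra! hlt
  -- A level `r > ‖A u‖` would need rank above `n`, but all its eigenvectors lie in the span of `v`:
  -- the component orthogonal to `v` is again an eigenvector and would be stretched by more than `‖A
  -- u‖`, so it vanishes.
  have hle : (⨆ t ∈ Set.Ici r, rightSingularSpace A t : Submodule ℝ H)
      ≤ Submodule.span ℝ (Set.range v) := by
    refine iSup₂_le fun t ht y hy => ?_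
    have hrt : r ≤ t := ht
    -- Eigenvectors for different eigenvalues are orthogonal, so only those `v j` with eigenvalue `t
    -- ^ 2` contribute.
    have hsum : ∑ j, inner ℝ (v j) y • v j ∈ rightSingularSpace A t := by
      refine Submodule.sum_mem _ fun j _ => ?_
      have h1 := inner_adjoint_comm A (v j) y
      rw [hvs, mem_rightSingularSpace.1 hy, real_inner_smul_left, real_inner_smul_right] at h1
      rw [mem_rightSingularSpace, map_smul, map_smul, hvs, smul_smul, smul_smul, mul_comm, h1]
    have hy' := Submodule.sub_mem _ hy hsum
    have h2 := norm_apply_of_mem_rightSingularSpace (hr0.trans hrt) hy'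
    have h3 := hmax _ (inner_sub_sum_inner_smul hv y)
    rw [h2] at h3
    have h4 : y - ∑ j, inner ℝ (v j) y • v j = 0 := by
      by_contra hne
      exact absurd (le_of_mul_le_mul_right h3 (norm_pos_iff.2 hne))
        (not_le.2 (hlt.trans_le hrt))
    rw [sub_eq_zero.1 h4]
    exact Submodule.sum_mem _ fun j _ => Submodule.smul_mem _ _
      (Submodule.subset_span (Set.mem_range_self j))
  exact absurd (hr.trans_le ((Submodule.rank_mono hle).trans (rank_span_range_fin_le v))) (lt_irrefl _)

/-- If `A` is bounded by its first `n` singular values on the complement of `n` top right singular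
vectors, then it is bounded there by the next one, and attains this bound. -/
theorem exists_next_rightSingularVector {A : H →L[ℝ] F} (hA : IsCompactOperator A) {n : ℕ}
    (hn : (n : Cardinal) < Module.rank ℝ H) {v : Fin n → H}
    (hv : IsTopRightSingularVectors A v)
    (hmax : ∀ i : Fin n, ∀ y, (∀ j, inner ℝ (v j) y = 0) → ‖A y‖ ≤ singularValue A i * ‖y‖) :
    ∃ u, ‖u‖ = 1 ∧ (∀ i, inner ℝ (v i) u = 0) ∧
      adjoint A (A u) = singularValue A n ^ 2 • u ∧
      ∀ y, (∀ i, inner ℝ (v i) y = 0) → ‖A y‖ ≤ singularValue A n * ‖y‖ := by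
  set V := Submodule.span ℝ (Set.range v) with hV
  have hmemK : ∀ y, y ∈ Vᗮ ↔ ∀ i, inner ℝ (v i) y = 0 := fun y => mem_orthogonal_span_range
  have hfin : FiniteDimensional ℝ V := FiniteDimensional.span_of_finite ℝ (Set.finite_range v)
  have hnt : Nontrivial Vᗮ := by
    rw [Submodule.nontrivial_iff_ne_bot]
    intro hbot
    rw [Submodule.orthogonal_eq_bot_iff] at hbot
    have h5 : Module.rank ℝ V ≤ n := rank_span_range_fin_le v
    rw [hbot, rank_top] at h5
    exact absurd hn (not_lt.2 h5)
  obtain ⟨u, huK, hu, hAu, hle⟩ := exists_rightSingularVector_mem A hA Vᗮ (by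
    intro y hy
    rw [hmemK] at hy ⊢
    intro i
    rw [← inner_adjoint_comm, hv.2, real_inner_smul_left, hy, mul_zero])
  rw [hmemK] at huK
  have hle' : ∀ y, (∀ i, inner ℝ (v i) y = 0) → ‖A y‖ ≤ ‖A u‖ * ‖y‖ :=
    fun y hy => hle y ((hmemK y).2 hy)
  have heq := singularValue_eq_of_forall_le hv.1 hv.2 hu huK hAu (fun i => by
    have := hmax i u huK
    rwa [hu, mul_one] at this) hle'
  exact ⟨u, hu, huK, by rw [heq, hAu], by rw [heq]; exact hle'⟩

/-- Top right singular vectors exist, and can be chosen so that `A` is bounded on their orthogonal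
complement by the next singular value. -/
theorem exists_isTopRightSingularVectors {A : H →L[ℝ] F} (hA : IsCompactOperator A) (n : ℕ)
    (hn : (n : Cardinal) ≤ Module.rank ℝ H) :
    ∃ v : Fin n → H, IsTopRightSingularVectors A v ∧
      ∀ y, (∀ i, inner ℝ (v i) y = 0) → ‖A y‖ ≤ singularValue A n * ‖y‖ := by
  -- The induction carries bounds by the singular values already found. They show that the next
  -- vector has no larger singular value, which is what `exists_next_rightSingularVector` requires.
  have key : ∀ n : ℕ, (n : Cardinal) ≤ Module.rank ℝ H →
      ∃ v : Fin n → H, IsTopRightSingularVectors A v ∧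
        ∀ i : Fin n, ∀ y, (∀ j, inner ℝ (v j) y = 0) → ‖A y‖ ≤ singularValue A i * ‖y‖ := by
    intro n
    induction n with
    | zero =>
      exact fun _ => ⟨Fin.elim0, ⟨⟨fun i => i.elim0, fun i => i.elim0⟩, fun i => i.elim0⟩,
        fun i => i.elim0⟩
    | succ n ih =>
      intro hn
      have hlt : (n : Cardinal) < Module.rank ℝ H :=
        lt_of_lt_of_le (by exact_mod_cast n.lt_succ_self) hn
      obtain ⟨v, hv, hmax⟩ := ih hlt.le
      obtain ⟨u, hu, hvu, hAu, hle⟩ := exists_next_rightSingularVector hA hlt hv hmax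
      refine ⟨Fin.snoc v u, ⟨orthonormal_snoc hv.1 hu hvu, ?_⟩, ?_⟩
      · intro i
        induction i using Fin.lastCases with
        | last => simpa using hAu
        | cast i => simpa using hv.2 i
      · intro i y hy
        have h1 := hle y fun j => by simpa using hy j.castSucc
        exact h1.trans (mul_le_mul_of_nonneg_right
          (singularValue_antitone A (Nat.lt_succ_iff.1 i.2)) (norm_nonneg _))
  -- Below full rank, one more extension step supplies the bound by `singularValue A n`; at full
  -- rank the orthogonal complement is zero.
  rcases hn.lt_or_eq with hlt | heq
  · obtain ⟨v, hv, hmax⟩ := key n hn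
    obtain ⟨-, -, -, -, hle⟩ := exists_next_rightSingularVector hA hlt hv hmax
    exact ⟨v, hv, hle⟩
  · obtain ⟨v, hv, -⟩ := key n hn
    refine ⟨v, hv, fun y hy => ?_⟩
    have hspan : Submodule.span ℝ (Set.range v) = ⊤ := by
      have : Module.Finite ℝ H := Module.rank_lt_aleph0_iff.1 (heq ▸ Cardinal.natCast_lt_aleph0)
      refine hv.1.linearIndependent.span_eq_top_of_card_eq_finrank' ?_
      rw [Fintype.card_fin, Module.finrank, ← heq, Cardinal.toNat_natCast]
    have hy0 : y = 0 := by
      have := mem_orthogonal_span_range.2 hy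
      rw [hspan] at this
      simpa using this
    simp [hy0]

end CompactOperators

end LeastSquaresFlats

namespace LeastSquaresFlats

/-! ### Bessel's inequality, Ky Fan's inequality and its equality case. -/

section Bessel

variable {H : Type*} [NormedAddCommGroup H] [InnerProductSpace ℝ H]

theorem sum_inner_sq_le_one {d : ℕ} {u : Fin d → H} (hu : Orthonormal ℝ u) {x : H}
    (hx : ‖x‖ = 1) : ∑ j, inner ℝ x (u j) ^ 2 ≤ 1 := by
  have h := hu.sum_inner_products_le x (s := Finset.univ)
  rw [hx, one_pow] at h
  refine le_of_eq_of_le (Finset.sum_congr rfl fun j _ => ?_) h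
  rw [Real.norm_eq_abs, sq_abs, real_inner_comm]

end Bessel

section KyFan

variable {H F : Type*} [NormedAddCommGroup H] [InnerProductSpace ℝ H] [CompleteSpace H]
  [NormedAddCommGroup F] [InnerProductSpace ℝ F] [CompleteSpace F]

theorem IsTopRightSingularVectors.sum_norm_sq {A : H →L[ℝ] F} {d : ℕ} {v : Fin d → H}
    (hv : IsTopRightSingularVectors A v) :
    ∑ i, ‖A (v i)‖ ^ 2 = ∑ i : Fin d, singularValue A i ^ 2 := by
  refine Finset.sum_congr rfl fun i _ => ?_
  rw [← inner_adjoint_apply_self, hv.2, real_inner_smul_left, real_inner_self_eq_norm_sq,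
    hv.1.1 i]
  ring

/-- The quadratic form of `A* A` is bounded by its diagonal part with respect to top right
singular vectors. -/
theorem IsTopRightSingularVectors.norm_sq_apply_le {A : H →L[ℝ] F} {d : ℕ} {v : Fin d → H}
    (hv : IsTopRightSingularVectors A v)
    (hmax : ∀ y, (∀ i, inner ℝ (v i) y = 0) → ‖A y‖ ≤ singularValue A d * ‖y‖) (y : H) :
    ‖A y‖ ^ 2 ≤ ∑ i : Fin d, (singularValue A i ^ 2 - singularValue A d ^ 2) * inner ℝ (v i) y ^ 2
      + singularValue A d ^ 2 * ‖y‖ ^ 2 := by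
  set p := ∑ j, inner ℝ (v j) y • v j with hp
  have hz := inner_sub_sum_inner_smul hv.1 y
  rw [← hp] at hz
  set z := y - p with hzdef
  have hy : y = p + z := by rw [hzdef]; abel
  have hpz : inner ℝ p z = 0 := by
    rw [hp, sum_inner]
    exact Finset.sum_eq_zero fun i _ => by rw [real_inner_smul_left, hz, mul_zero]
  have hTp : ContinuousLinearMap.adjoint A (A p)
      = ∑ j : Fin d, (inner ℝ (v j) y * singularValue A j ^ 2) • v j := by
    simp only [hp, map_sum, map_smul, hv.2, smul_smul]
  -- `A* A` maps the span of `v` into itself, so the orthogonal splitting of `y` stays orthogonal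
  -- under `A`.
  have hTpz : inner ℝ (A p) (A z) = 0 := by
    rw [← ContinuousLinearMap.adjoint_inner_left, hTp, sum_inner]
    exact Finset.sum_eq_zero fun i _ => by rw [real_inner_smul_left, hz, mul_zero]
  have hpv : ∀ i, inner ℝ (v i) p = inner ℝ (v i) y := fun i => by
    rw [hp, hv.1.inner_right_fintype]
  have hp2 : ‖p‖ ^ 2 = ∑ i, inner ℝ (v i) y ^ 2 := by
    rw [← real_inner_self_eq_norm_sq]
    nth_rw 1 [hp]
    rw [sum_inner]
    exact Finset.sum_congr rfl fun i _ => by rw [real_inner_smul_left, hpv, sq]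
  have hAp : ‖A p‖ ^ 2 = ∑ i : Fin d, singularValue A i ^ 2 * inner ℝ (v i) y ^ 2 := by
    rw [← inner_adjoint_apply_self, hTp, sum_inner]
    exact Finset.sum_congr rfl fun i _ => by rw [real_inner_smul_left, hpv]; ring
  have hAz : ‖A z‖ ^ 2 ≤ singularValue A d ^ 2 * ‖z‖ ^ 2 := by
    rw [← mul_pow]
    exact pow_le_pow_left₀ (norm_nonneg _) (hmax z hz) 2
  have hyn : ‖y‖ ^ 2 = ‖p‖ ^ 2 + ‖z‖ ^ 2 := by
    rw [hy, norm_add_sq_real, hpz]; ring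
  have hAy : ‖A y‖ ^ 2 = ‖A p‖ ^ 2 + ‖A z‖ ^ 2 := by
    rw [hy, map_add, norm_add_sq_real, hTpz]; ring
  simp only [sub_mul, Finset.sum_sub_distrib, ← Finset.mul_sum, ← hp2]
  rw [hAy, hyn, hAp]
  linarith

/-- The double sum is ordered so that each nonnegative weight multiplies a Bessel sum, which is at
most `1`. Both Ky Fan's inequality and its equality case are read off from this form. -/
theorem IsTopRightSingularVectors.sum_norm_sq_apply_le {A : H →L[ℝ] F} {d : ℕ} {v : Fin d → H}
    (hv : IsTopRightSingularVectors A v)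
    (hmax : ∀ y, (∀ i, inner ℝ (v i) y = 0) → ‖A y‖ ≤ singularValue A d * ‖y‖)
    {u : Fin d → H} (hu : Orthonormal ℝ u) :
    ∑ j, ‖A (u j)‖ ^ 2 ≤ ∑ i : Fin d, (singularValue A i ^ 2 - singularValue A d ^ 2) *
      ∑ j, inner ℝ (v i) (u j) ^ 2 + d * singularValue A d ^ 2 := by
  refine (Finset.sum_le_sum fun j _ => hv.norm_sq_apply_le hmax (u j)).trans_eq ?_
  rw [Finset.sum_add_distrib, Finset.sum_comm]
  simp only [hu.1, ← Finset.mul_sum]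
  simp
  ring

theorem singularValue_sq_le (A : H →L[ℝ] F) {d : ℕ} (i : Fin d) :
    singularValue A d ^ 2 ≤ singularValue A i ^ 2 :=
  pow_le_pow_left₀ (singularValue_nonneg A d) (singularValue_antitone A i.2.le) 2

/-- Ky Fan's inequality for the squares of singular values. -/
theorem sum_norm_sq_apply_le_sum_singularValue_sq {A : H →L[ℝ] F} (hA : IsCompactOperator A)
    {d : ℕ} {u : Fin d → H} (hu : Orthonormal ℝ u) :
    ∑ j, ‖A (u j)‖ ^ 2 ≤ ∑ i : Fin d, singularValue A i ^ 2 := by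
  obtain ⟨v, hv, hmax⟩ := exists_isTopRightSingularVectors hA d
    (natCast_le_rank_of_linearIndependent hu.linearIndependent)
  refine (hv.sum_norm_sq_apply_le hmax hu).trans ?_
  have : ∑ i : Fin d, (singularValue A i ^ 2 - singularValue A d ^ 2) *
      ∑ j, inner ℝ (v i) (u j) ^ 2 ≤ ∑ i : Fin d, (singularValue A i ^ 2 - singularValue A d ^ 2) :=
    Finset.sum_le_sum fun i _ => mul_le_of_le_one_right (sub_nonneg.2 (singularValue_sq_le A i))
      (sum_inner_sq_le_one hu (hv.1.1 i))
  rw [Finset.sum_sub_distrib] at this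
  simp at this
  linarith

/-- The equality case of Ky Fan's inequality at a spectral gap: the span is determined. -/
theorem IsTopRightSingularVectors.span_eq_of_sum_norm_sq_eq {A : H →L[ℝ] F} {d : ℕ}
    {v : Fin d → H} (hv : IsTopRightSingularVectors A v)
    (hmax : ∀ y, (∀ i, inner ℝ (v i) y = 0) → ‖A y‖ ≤ singularValue A d * ‖y‖)
    (hgap : ∀ i : Fin d, singularValue A d < singularValue A i)
    {u : Fin d → H} (hu : Orthonormal ℝ u)
    (heq : ∑ j, ‖A (u j)‖ ^ 2 = ∑ i : Fin d, singularValue A i ^ 2) :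
    Submodule.span ℝ (Set.range u) = Submodule.span ℝ (Set.range v) := by
  have hpos : ∀ i : Fin d, 0 < singularValue A i ^ 2 - singularValue A d ^ 2 := fun i =>
    sub_pos.2 (pow_lt_pow_left₀ (hgap i) (singularValue_nonneg A d) two_ne_zero)
  have hle := hv.sum_norm_sq_apply_le hmax hu
  -- Equality forces the weighted Bessel defects to sum to zero. The gap makes every weight
  -- positive, so each `v i` has equality in Bessel's inequality and thus lies in the span of `u`.
  have hterm : ∀ i ∈ Finset.univ, 0 ≤ (singularValue A (i : Fin d) ^ 2 - singularValue A d ^ 2) *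
      (1 - ∑ j, inner ℝ (v i) (u j) ^ 2) := fun i _ =>
    mul_nonneg (hpos i).le (sub_nonneg.2 (sum_inner_sq_le_one hu (hv.1.1 i)))
  have hsum : ∑ i : Fin d, (singularValue A i ^ 2 - singularValue A d ^ 2) *
      (1 - ∑ j, inner ℝ (v i) (u j) ^ 2) = 0 := by
    refine le_antisymm ?_ (Finset.sum_nonneg hterm)
    simp only [mul_one_sub, Finset.sum_sub_distrib]
    simp at hle ⊢
    linarith
  have hone : ∀ i, ∑ j, inner ℝ (v i) (u j) ^ 2 = 1 := fun i => by
    have h := (Finset.sum_eq_zero_iff_of_nonneg hterm).1 hsum i (Finset.mem_univ i)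
    linarith [(mul_eq_zero.1 h).resolve_left (hpos i).ne']
  have hmem : ∀ i, v i ∈ Submodule.span ℝ (Set.range u) := fun i => by
    have hz := inner_sub_sum_inner_smul hu (v i)
    have h0 : v i - ∑ j, inner ℝ (u j) (v i) • u j = 0 := by
      rw [← inner_self_eq_zero (𝕜 := ℝ)]
      nth_rw 1 [inner_sub_left]
      rw [sum_inner]
      simp only [real_inner_smul_left, hz, mul_zero, Finset.sum_const_zero, sub_zero]
      rw [inner_sub_right, real_inner_self_eq_norm_sq, hv.1.1 i, inner_sum]
      simp only [real_inner_smul_right, real_inner_comm (v i) (u _)]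
      have := hone i
      simp only [sq] at this
      rw [this]; norm_num
    rw [sub_eq_zero.1 h0]
    exact Submodule.sum_mem _ fun j _ => Submodule.smul_mem _ _
      (Submodule.subset_span (Set.mem_range_self j))
  have hfin : FiniteDimensional ℝ (Submodule.span ℝ (Set.range u)) :=
    FiniteDimensional.span_of_finite ℝ (Set.finite_range u)
  refine (Submodule.eq_of_le_of_finrank_eq (Submodule.span_le.2 ?_) ?_).symm
  · rintro _ ⟨i, rfl⟩
    exact hmem i
  · rw [finrank_span_eq_card hv.1.linearIndependent, finrank_span_eq_card hu.linearIndependent]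

end KyFan

/-! ### Orthonormal bases of flats and the distance to a flat. -/

section Flats

variable {H : Type*} [NormedAddCommGroup H] [InnerProductSpace ℝ H]

theorem exists_orthonormal_of_mem_affineGrassmannian {d : ℕ} {L : AffineSubspace ℝ H}
    (hL : L ∈ affineGrassmannian H d) :
    ∃ u : Fin d → H, Orthonormal ℝ u ∧ Submodule.span ℝ (Set.range u) = L.direction := by
  have hfin : FiniteDimensional ℝ L.direction :=
    Module.rank_lt_aleph0_iff.1 (hL.2 ▸ Cardinal.natCast_lt_aleph0)
  have hd : Module.finrank ℝ L.direction = d := by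
    rw [Module.finrank, hL.2, Cardinal.toNat_natCast]
  let b := (stdOrthonormalBasis ℝ L.direction).reindex (finCongr hd)
  refine ⟨fun i => b i, b.orthonormal.comp_linearIsometry L.direction.subtypeₗᵢ, ?_⟩
  have : Set.range (fun i => (b i : H)) = L.direction.subtype '' Set.range b := by
    rw [← Set.range_comp]; rfl
  rw [this, Submodule.span_image, ← OrthonormalBasis.coe_toBasis, Module.Basis.span_eq,
    Submodule.map_top, Submodule.range_subtype]

theorem mk'_mem_affineGrassmannian {d : ℕ} {v : Fin d → H} (hv : LinearIndependent ℝ v) (p : H) :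
    AffineSubspace.mk' p (Submodule.span ℝ (Set.range v)) ∈ affineGrassmannian H d := by
  refine ⟨⟨p, AffineSubspace.self_mem_mk' _ _⟩, ?_⟩
  have : FiniteDimensional ℝ (Submodule.span ℝ (Set.range v)) :=
    FiniteDimensional.span_of_finite ℝ (Set.finite_range v)
  rw [AffineSubspace.direction_mk', ← Module.finrank_eq_rank, finrank_span_eq_card hv,
    Fintype.card_fin]

/-- Pythagoras: the orthogonal projection of `x` to `L` is `p` plus the projection of `x - p` to the
direction. -/
theorem infDist_sq_eq {d : ℕ} {L : AffineSubspace ℝ H} {p : H} (hp : p ∈ L) {u : Fin d → H}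
    (hu : Orthonormal ℝ u) (hL : Submodule.span ℝ (Set.range u) = L.direction) (x : H) :
    Metric.infDist x (L : Set H) ^ 2 = ‖x - p‖ ^ 2 - ∑ j, inner ℝ (u j) (x - p) ^ 2 := by
  have hfin : FiniteDimensional ℝ L.direction := by
    rw [← hL]; exact FiniteDimensional.span_of_finite ℝ (Set.finite_range u)
  have : Nonempty L := ⟨⟨p, hp⟩⟩
  set w := ∑ j, inner ℝ (u j) (x - p) • u j with hw
  have hz := inner_sub_sum_inner_smul hu (x - p)
  rw [← hw] at hz
  have hwL : w ∈ L.direction := by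
    rw [← hL]
    exact Submodule.sum_mem _ fun j _ => Submodule.smul_mem _ _
      (Submodule.subset_span (Set.mem_range_self j))
  have hproj : (EuclideanGeometry.orthogonalProjection L x : H) = w + p := by
    rw [EuclideanGeometry.coe_orthogonalProjection_eq_iff_mem]
    refine ⟨AffineSubspace.vadd_mem_of_mem_direction hwL hp, ?_⟩
    rw [← hL, mem_orthogonal_span_range]
    intro i
    rw [← hz i, vsub_eq_sub, sub_add_eq_sub_sub, sub_right_comm]
  have h1 := EuclideanGeometry.dist_orthogonalProjection_eq_infDist L x
  rw [← h1, dist_eq_norm, hproj, add_comm w p, ← sub_sub]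
  have hwz : inner ℝ w (x - p - w) = 0 := by
    nth_rw 1 [hw]
    rw [sum_inner]
    exact Finset.sum_eq_zero fun i _ => by rw [real_inner_smul_left, hz, mul_zero]
  have hw2 : ‖w‖ ^ 2 = ∑ j, inner ℝ (u j) (x - p) ^ 2 := by
    rw [← real_inner_self_eq_norm_sq]
    nth_rw 1 [hw]
    rw [sum_inner]
    exact Finset.sum_congr rfl fun i _ => by
      rw [real_inner_smul_left, hw, hu.inner_right_fintype, sq]
  have h2 : ‖x - p‖ ^ 2 = ‖w‖ ^ 2 + ‖x - p - w‖ ^ 2 := by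
    rw [show x - p = w + (x - p - w) by abel, norm_add_sq_real]
    simp only [add_sub_cancel_left]
    rw [hwz]; ring
  rw [← hw2, h2, norm_sub_rev]
  ring

end Flats

end LeastSquaresFlats

namespace LeastSquaresFlats

/-! ### Compactness of the data-to-features operator, its Hilbert–Schmidt norm, and the mean square
distance. -/

section Operator

variable {H : Type*} [NormedAddCommGroup H] [InnerProductSpace ℝ H]

/-- Orthonormal vectors have mutual distance `√2 > 1`, so balls of radius `1/2` around them are
disjoint. Countability is needed to interchange sum and integral. -/
theorem countable_of_orthonormal [TopologicalSpace.SeparableSpace H] {ι : Type*} {b : ι → H}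
    (hb : Orthonormal ℝ b) : Countable ι := by
  have h : (Set.univ : Set ι).PairwiseDisjoint fun i => Metric.ball (b i) (1 / 2) := by
    intro i _ j _ hij
    refine Metric.ball_disjoint_ball ?_
    have h2 : ‖b i - b j‖ ^ 2 = 2 := by
      rw [norm_sub_sq_real, hb.1, hb.1, hb.2 hij]; norm_num
    rw [dist_eq_norm]
    nlinarith [norm_nonneg (b i - b j)]
  exact Set.countable_univ_iff.1 (h.countable_of_isOpen (fun _ _ => Metric.isOpen_ball)
    fun i _ => ⟨b i, Metric.mem_ball_self (by norm_num)⟩)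

variable [MeasurableSpace H]

/-- The operator `y ↦ ⟪y, f ·⟫` attached to `f ∈ L²(μ; H)`, as a function of `f`. -/
noncomputable def innerLp (μ : Measure H) : Lp H 2 μ →L[ℝ] H →L[ℝ] Lp ℝ 2 μ :=
  LinearMap.mkContinuous₂
    (LinearMap.mk₂ ℝ (fun f y => (innerSL ℝ y).compLp f)
      (fun f g y => ((innerSL ℝ y).compLpL 2 μ).map_add f g)
      (fun c f y => ((innerSL ℝ y).compLpL 2 μ).map_smul c f)
      (fun f y z => by rw [map_add, ContinuousLinearMap.add_compLp])
      (fun c f y => by rw [map_smul, ContinuousLinearMap.smul_compLp]))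
    1
    (fun f y => by
      have h := (innerSL ℝ y).norm_compLp_le f
      rw [innerSL_apply_norm] at h
      rw [one_mul, mul_comm]
      exact h)

theorem innerLp_apply (μ : Measure H) (f : Lp H 2 μ) (y : H) :
    innerLp μ f y = (innerSL ℝ y).compLp f := rfl

/-- Integral operators with a square integrable kernel are compact. -/
theorem isCompactOperator_innerLp (μ : Measure H) (f : Lp H 2 μ) :
    IsCompactOperator (innerLp μ f) := by
  refine Lp.induction (p := 2) ENNReal.ofNat_ne_top
    (motive := fun f => IsCompactOperator (innerLp μ f)) ?_ ?_ ?_ f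
  · intro c s hs hμs
    -- The kernel `c · 1_s` gives the operator `y ↦ ⟪c, y⟫ · 1_s`, which factors through `ℝ`.
    have heq : innerLp μ (Lp.simpleFunc.indicatorConst 2 hs hμs.ne c : Lp H 2 μ) =
        (ContinuousLinearMap.toSpanSingleton ℝ (indicatorConstLp 2 hs hμs.ne (1 : ℝ))).comp
          (innerSL ℝ c) := by
      ext1 y
      rw [innerLp_apply, Lp.simpleFunc.coe_indicatorConst]
      refine Lp.ext ?_
      have h3 := Lp.coeFn_smul (inner ℝ c y : ℝ) (indicatorConstLp 2 hs hμs.ne (1 : ℝ) : Lp ℝ 2 μ)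
      filter_upwards [(innerSL ℝ y).coeFn_compLp (indicatorConstLp 2 hs hμs.ne c),
        indicatorConstLp_coeFn (p := 2) (hs := hs) (hμs := hμs.ne) (c := c),
        indicatorConstLp_coeFn (p := 2) (hs := hs) (hμs := hμs.ne) (c := (1 : ℝ)), h3]
        with x h1 h2 h4 h5
      rw [h1, h2]
      change _ = ((inner ℝ c y : ℝ) • (indicatorConstLp 2 hs hμs.ne (1 : ℝ) : Lp ℝ 2 μ) : Lp ℝ 2 μ) x
      rw [h5, Pi.smul_apply, h4]
      by_cases hx : x ∈ s
      · rw [Set.indicator_of_mem hx, Set.indicator_of_mem hx]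
        simp [real_inner_comm]
      · rw [Set.indicator_of_notMem hx, Set.indicator_of_notMem hx]
        simp
    rw [heq]
    exact (isCompactOperator_of_locallyCompactSpace_rng
      (ContinuousLinearMap.toSpanSingleton ℝ _)).comp_clm (innerSL ℝ c)
  · intro f g hf hg _ h1 h2
    rw [map_add]
    exact h1.add h2
  -- Compact operators are closed in operator norm, and the operator depends continuously on its
  -- kernel.
  · exact isClosed_setOfPred_isCompactOperator.preimage (innerLp μ).continuous

variable [TopologicalSpace.SeparableSpace H] [BorelSpace H]

theorem isCompactOperator_dataToFeatures (μ : Measure H) [IsProbabilityMeasure μ]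
    (hμ : Bornology.IsBounded μ.support) : IsCompactOperator (dataToFeatures μ hμ) :=
  isCompactOperator_innerLp μ ((memLp_sub_centerOfMass μ hμ).toLp _)

theorem memLp_inner_sub_centerOfMass (μ : Measure H) [IsProbabilityMeasure μ]
    (hμ : Bornology.IsBounded μ.support) (y : H) :
    MemLp (fun x => inner ℝ y (x - centerOfMass μ)) 2 μ :=
  (memLp_sub_centerOfMass μ hμ).const_inner y

theorem norm_dataToFeatures_sq (μ : Measure H) [IsProbabilityMeasure μ]
    (hμ : Bornology.IsBounded μ.support) (y : H) :
    ‖dataToFeatures μ hμ y‖ ^ 2 = ∫ x, inner ℝ y (x - centerOfMass μ) ^ 2 ∂μ := by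
  rw [← real_inner_self_eq_norm_sq, L2.inner_def]
  refine integral_congr_ae ?_
  filter_upwards [dataToFeatures_ae μ hμ y] with x hx
  rw [hx, real_inner_self_eq_norm_sq, Real.norm_eq_abs, sq_abs]

theorem integrable_inner_sub_centerOfMass_sq (μ : Measure H) [IsProbabilityMeasure μ]
    (hμ : Bornology.IsBounded μ.support) (y : H) :
    Integrable (fun x => inner ℝ y (x - centerOfMass μ) ^ 2) μ :=
  (memLp_inner_sub_centerOfMass μ hμ y).integrable_sq

theorem integrable_norm_sub_centerOfMass_sq (μ : Measure H) [IsProbabilityMeasure μ]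
    (hμ : Bornology.IsBounded μ.support) :
    Integrable (fun x => ‖x - centerOfMass μ‖ ^ 2) μ :=
  (memLp_sub_centerOfMass μ hμ).norm.integrable_sq

/-- The total variance `∫ ‖x - x_cm‖² dμ(x)`. -/
noncomputable def totalVariance (μ : Measure H) : ℝ := ∫ x, ‖x - centerOfMass μ‖ ^ 2 ∂μ

/-- Bessel's inequality for `x - x_cm`, integrated over `μ`. -/
theorem sum_norm_dataToFeatures_sq_le (μ : Measure H) [IsProbabilityMeasure μ]
    (hμ : Bornology.IsBounded μ.support) {ι : Type*} {b : ι → H} (hb : Orthonormal ℝ b)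
    (s : Finset ι) : ∑ i ∈ s, ‖dataToFeatures μ hμ (b i)‖ ^ 2 ≤ totalVariance μ := by
  simp only [norm_dataToFeatures_sq, totalVariance]
  rw [← integral_finsetSum s fun i _ => integrable_inner_sub_centerOfMass_sq μ hμ (b i)]
  refine integral_mono (integrable_finsetSum s fun i _ =>
    integrable_inner_sub_centerOfMass_sq μ hμ (b i)) (integrable_norm_sub_centerOfMass_sq μ hμ)
    fun x => ?_
  have h := hb.sum_inner_products_le (x - centerOfMass μ) (s := s)
  simpa only [Real.norm_eq_abs, sq_abs] using h

/-- Parseval's identity for `x - x_cm`, integrated term by term: the squared Hilbert–Schmidt norm of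
the operator is the total variance. -/
theorem hasSum_norm_dataToFeatures_sq (μ : Measure H) [IsProbabilityMeasure μ]
    (hμ : Bornology.IsBounded μ.support) {ι : Type*} (b : HilbertBasis ι ℝ H) :
    HasSum (fun i => ‖dataToFeatures μ hμ (b i)‖ ^ 2) (totalVariance μ) := by
  have : Countable ι := countable_of_orthonormal b.orthonormal
  have hsum : Summable fun i => ‖dataToFeatures μ hμ (b i)‖ ^ 2 :=
    summable_of_sum_le (fun _ => sq_nonneg _)
      (sum_norm_dataToFeatures_sq_le μ hμ b.orthonormal)
  have hnorm : ∀ (i : ι) (x : H), ‖(inner ℝ (b i) (x - centerOfMass μ) : ℝ) ^ 2‖ =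
      inner ℝ (b i) (x - centerOfMass μ) ^ 2 := fun i x => Real.norm_of_nonneg (sq_nonneg _)
  have h := hasSum_integral_of_summable_integral_norm
    (F := fun (i : ι) x => (inner ℝ (b i) (x - centerOfMass μ) : ℝ) ^ 2) (μ := μ)
    (fun i => integrable_inner_sub_centerOfMass_sq μ hμ (b i))
    (by simpa only [hnorm, norm_dataToFeatures_sq] using hsum)
  simp only [norm_dataToFeatures_sq, totalVariance]
  have hpars : ∀ x, ‖x - centerOfMass μ‖ ^ 2 =
      ∑' i, (inner ℝ (b i) (x - centerOfMass μ) : ℝ) ^ 2 := fun x => by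
    have h2 := b.hasSum_inner_mul_inner (x - centerOfMass μ) (x - centerOfMass μ)
    rw [real_inner_self_eq_norm_sq] at h2
    rw [← h2.tsum_eq]
    exact tsum_congr fun i => by rw [real_inner_comm, sq]
  simp only [hpars]
  exact h

variable [CompleteSpace H]

theorem sum_range_singularValue_sq_le (μ : Measure H) [IsProbabilityMeasure μ]
    (hμ : Bornology.IsBounded μ.support) (n : ℕ) :
    ∑ i ∈ Finset.range n, singularValue (dataToFeatures μ hμ) i ^ 2 ≤ totalVariance μ := by
  have hA := isCompactOperator_dataToFeatures μ hμ
  have key : ∀ n : ℕ, (n : Cardinal) ≤ Module.rank ℝ H →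
      ∑ i ∈ Finset.range n, singularValue (dataToFeatures μ hμ) i ^ 2 ≤ totalVariance μ := by
    intro n hn
    obtain ⟨v, hv, -⟩ := exists_isTopRightSingularVectors hA n hn
    rw [Finset.sum_range, ← hv.sum_norm_sq]
    exact sum_norm_dataToFeatures_sq_le μ hμ hv.1 Finset.univ
  induction n with
  | zero => exact key 0 (by simp)
  | succ n ih =>
    -- Singular vectors exist only up to the dimension; beyond it the added terms are zero.
    rcases lt_or_ge (n : Cardinal) (Module.rank ℝ H) with hlt | hge
    · refine key (n + 1) ?_
      rw [Nat.cast_add, Nat.cast_one, ← Cardinal.succ_natCast]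
      exact Order.succ_le_of_lt hlt
    · rw [Finset.sum_range_succ, singularValue_eq_zero_of_rank_le _ hge]
      simpa using ih

/-- The squares of the singular values sum up to the total variance. -/
theorem hasSum_singularValue_sq (μ : Measure H) [IsProbabilityMeasure μ]
    (hμ : Bornology.IsBounded μ.support) :
    HasSum (fun i => singularValue (dataToFeatures μ hμ) i ^ 2) (totalVariance μ) := by
  have hnn : ∀ i, 0 ≤ singularValue (dataToFeatures μ hμ) i ^ 2 := fun _ => sq_nonneg _
  have hs : Summable fun i => singularValue (dataToFeatures μ hμ) i ^ 2 :=
    summable_of_sum_range_le hnn (sum_range_singularValue_sq_le μ hμ)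
  have hle := Real.tsum_le_of_sum_range_le hnn (sum_range_singularValue_sq_le μ hμ)
  -- By Ky Fan, a partial sum over finitely many vectors of a Hilbert basis is at most the sum of
  -- equally many leading `σ_i²`.
  have hge : totalVariance μ ≤ ∑' i, singularValue (dataToFeatures μ hμ) i ^ 2 := by
    obtain ⟨w, b, -⟩ := exists_hilbertBasis ℝ H
    refine le_of_tendsto (hasSum_norm_dataToFeatures_sq μ hμ b) (Filter.Eventually.of_forall ?_)
    intro s
    let e := s.equivFin.symm
    have ho : Orthonormal ℝ fun j => b (e j) :=
      b.orthonormal.comp _ (Subtype.val_injective.comp e.injective)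
    have h := sum_norm_sq_apply_le_sum_singularValue_sq
      (isCompactOperator_dataToFeatures μ hμ) ho
    rw [e.sum_comp fun j : s => ‖dataToFeatures μ hμ (b j)‖ ^ 2,
      Finset.sum_coe_sort s fun j => ‖dataToFeatures μ hμ (b j)‖ ^ 2] at h
    refine h.trans ?_
    rw [← Finset.sum_range fun i => singularValue (dataToFeatures μ hμ) i ^ 2]
    exact hs.sum_le_tsum _ fun i _ => hnn i
  rw [le_antisymm hge hle]
  exact hs.hasSum

/-- The mean square distance of `μ` to a `d`-flat, in terms of an orthonormal basis of its
direction. -/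
theorem integral_infDist_sq (μ : Measure H) [IsProbabilityMeasure μ]
    (hμ : Bornology.IsBounded μ.support) {d : ℕ} {L : AffineSubspace ℝ H}
    (hne : (L : Set H).Nonempty) {u : Fin d → H} (hu : Orthonormal ℝ u)
    (hL : Submodule.span ℝ (Set.range u) = L.direction) :
    ∫ x, Metric.infDist x (L : Set H) ^ 2 ∂μ = totalVariance μ
      - ∑ j, ‖dataToFeatures μ hμ (u j)‖ ^ 2 + Metric.infDist (centerOfMass μ) (L : Set H) ^ 2 := by
  obtain ⟨p, hp⟩ := hne
  set c := centerOfMass μ with hc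
  have : SecondCountableTopology H := UniformSpace.secondCountable_of_separable H
  have hint : Integrable (fun x => x - c) μ :=
    (memLp_sub_centerOfMass μ hμ).integrable one_le_two
  have hcm : ∫ x, (x - c) ∂μ = 0 := by
    have hid : Integrable (fun x : H => x) μ := by
      refine (hint.add (integrable_const c)).congr (Filter.Eventually.of_forall fun x => ?_)
      exact sub_add_cancel x c
    rw [integral_sub hid (integrable_const c)]
    simp [hc, centerOfMass]
  have hlin : ∀ y : H, ∫ x, inner ℝ y (x - c) ∂μ = 0 := fun y => by
    rw [integral_inner hint, hcm, inner_zero_right]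
  have hi1 : ∀ y : H, Integrable (fun x => inner ℝ y (x - c)) μ := fun y => hint.const_inner y
  -- Recentering from `p` to `c` produces a cross term linear in `x - c`, whose integral is zero,
  -- and the constant `dist²(c, L)`.
  have hpt : ∀ x, Metric.infDist x (L : Set H) ^ 2 =
      (‖x - c‖ ^ 2 - ∑ j, inner ℝ (u j) (x - c) ^ 2) +
      (inner ℝ ((2 : ℝ) • ((c - p) - ∑ j, inner ℝ (u j) (c - p) • u j)) (x - c) +
        Metric.infDist c (L : Set H) ^ 2) := fun x => by
    rw [infDist_sq_eq hp hu hL, infDist_sq_eq hp hu hL, ← sub_add_sub_cancel x c p]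
    generalize x - c = a
    generalize c - p = b
    simp only [inner_add_right, add_sq, Finset.sum_add_distrib, norm_add_sq_real,
      real_inner_smul_left, inner_sub_left, sum_inner]
    have : ∑ j, 2 * inner ℝ (u j) a * inner ℝ (u j) b =
        2 * ∑ j, inner ℝ (u j) b * inner ℝ (u j) a := by
      rw [Finset.mul_sum]
      exact Finset.sum_congr rfl fun j _ => by ring
    rw [this, real_inner_comm a b]
    ring
  have hi2 : Integrable (fun x => ‖x - c‖ ^ 2) μ := integrable_norm_sub_centerOfMass_sq μ hμ
  have hi3 : Integrable (fun x => ∑ j, inner ℝ (u j) (x - c) ^ 2) μ :=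
    integrable_finsetSum _ fun j _ => integrable_inner_sub_centerOfMass_sq μ hμ (u j)
  have hi4 : Integrable (fun x => ‖x - c‖ ^ 2 - ∑ j, inner ℝ (u j) (x - c) ^ 2) μ := hi2.sub hi3
  have hi5 : ∀ (y : H) (r : ℝ), Integrable (fun x => inner ℝ y (x - c) + r) μ := fun y r =>
    (hi1 y).add (integrable_const r)
  rw [integral_congr_ae (Filter.Eventually.of_forall hpt),
    integral_add hi4 (hi5 _ _), integral_sub hi2 hi3,
    integral_add (hi1 _) (integrable_const _), hlin,
    integral_finsetSum _ fun j _ => integrable_inner_sub_centerOfMass_sq μ hμ (u j)]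
  rw [integral_const, probReal_univ, one_smul, zero_add, totalVariance, ← hc]
  congr 2
  exact Finset.sum_congr rfl fun j _ => (norm_dataToFeatures_sq μ hμ (u j)).symm

end Operator

theorem eq_top_of_mem_affineGrassmannian {H : Type*} [NormedAddCommGroup H]
    [InnerProductSpace ℝ H] {d : ℕ} (hd : (d : Cardinal) = Module.rank ℝ H)
    {L : AffineSubspace ℝ H} (hL : L ∈ affineGrassmannian H d) : L = ⊤ := by
  have : Module.Finite ℝ H := Module.rank_lt_aleph0_iff.1 (hd ▸ Cardinal.natCast_lt_aleph0)
  have h : L.direction = ⊤ := by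
    refine Submodule.eq_top_of_finrank_eq ?_
    rw [Module.finrank, Module.finrank, hL.2, hd]
  exact (AffineSubspace.direction_eq_top_iff_of_nonempty hL.1).1 h

/-! ### Least squares flats: optimality, error and uniqueness. -/

section LeastSquares

variable {H : Type*} [NormedAddCommGroup H] [InnerProductSpace ℝ H] [CompleteSpace H]
  [TopologicalSpace.SeparableSpace H] [MeasurableSpace H] [BorelSpace H]
  (μ : Measure H) [IsProbabilityMeasure μ] (hμ : Bornology.IsBounded μ.support)

theorem tsum_singularValue_sq_tail (d : ℕ) :
    ∑' i, singularValue (dataToFeatures μ hμ) (d + i) ^ 2 =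
      totalVariance μ - ∑ i : Fin d, singularValue (dataToFeatures μ hμ) i ^ 2 := by
  have h := hasSum_singularValue_sq μ hμ
  rw [← Finset.sum_range fun i => singularValue (dataToFeatures μ hμ) i ^ 2,
    ← h.tsum_eq, ← h.summable.sum_add_tsum_nat_add d]
  simp [add_comm]

/-- In the formula for the mean square distance, drop the offset from the center of mass and apply
Ky Fan. -/
theorem sqrt_tail_le_rmsDist {d : ℕ} {L : AffineSubspace ℝ H} (hL : L ∈ affineGrassmannian H d) :
    √(∑' i, singularValue (dataToFeatures μ hμ) (d + i) ^ 2) ≤ rmsDist μ L := by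
  obtain ⟨u, hu, hspan⟩ := exists_orthonormal_of_mem_affineGrassmannian hL
  refine Real.sqrt_le_sqrt ?_
  rw [integral_infDist_sq μ hμ hL.1 hu hspan, tsum_singularValue_sq_tail]
  have := sum_norm_sq_apply_le_sum_singularValue_sq (isCompactOperator_dataToFeatures μ hμ) hu
  linarith [sq_nonneg (Metric.infDist (centerOfMass μ) (L : Set H))]

theorem rmsDist_mk'_span {d : ℕ} {v : Fin d → H}
    (hv : IsTopRightSingularVectors (dataToFeatures μ hμ) v) :
    rmsDist μ (AffineSubspace.mk' (centerOfMass μ) (Submodule.span ℝ (Set.range v))) =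
      √(∑' i, singularValue (dataToFeatures μ hμ) (d + i) ^ 2) := by
  have hmem := mk'_mem_affineGrassmannian hv.1.linearIndependent (centerOfMass μ)
  rw [rmsDist, integral_infDist_sq μ hμ hmem.1 hv.1 (AffineSubspace.direction_mk' _ _).symm,
    hv.sum_norm_sq, tsum_singularValue_sq_tail,
    Metric.infDist_zero_of_mem (AffineSubspace.self_mem_mk' _ _)]
  simp

theorem isLSFlat_mk'_span {d : ℕ} {v : Fin d → H}
    (hv : IsTopRightSingularVectors (dataToFeatures μ hμ) v) :
    IsLSFlat μ d
      (AffineSubspace.mk' (centerOfMass μ) (Submodule.span ℝ (Set.range v))) := by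
  refine ⟨mk'_mem_affineGrassmannian hv.1.linearIndependent _, fun L hL => ?_⟩
  change rmsDist μ _ ≤ rmsDist μ L
  rw [rmsDist_mk'_span μ hμ hv]
  exact sqrt_tail_le_rmsDist μ hμ hL

theorem lsError_eq_sqrt_tail {d : ℕ} (hd : (d : Cardinal) ≤ Module.rank ℝ H) :
    lsError μ d = √(∑' i, singularValue (dataToFeatures μ hμ) (d + i) ^ 2) := by
  obtain ⟨v, hv, -⟩ :=
    exists_isTopRightSingularVectors (isCompactOperator_dataToFeatures μ hμ) d hd
  have hmem := mk'_mem_affineGrassmannian hv.1.linearIndependent (centerOfMass μ)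
  have : Nonempty (affineGrassmannian H d) := ⟨⟨_, hmem⟩⟩
  refine le_antisymm ?_ (le_ciInf fun L => sqrt_tail_le_rmsDist μ hμ L.2)
  rw [← rmsDist_mk'_span μ hμ hv]
  exact ciInf_le (f := fun L : affineGrassmannian H d => rmsDist μ (L : AffineSubspace ℝ H))
    ⟨0, by rintro _ ⟨L, rfl⟩; exact Real.sqrt_nonneg _⟩ ⟨_, hmem⟩

/-- The error of a least squares flat is attained in its location and in its direction. -/
theorem IsLSFlat.centerOfMass_mem_and_sum_eq {d : ℕ} {L : AffineSubspace ℝ H}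
    (hL : IsLSFlat μ d L) {u : Fin d → H} (hu : Orthonormal ℝ u)
    (hspan : Submodule.span ℝ (Set.range u) = L.direction) :
    centerOfMass μ ∈ L ∧ ∑ j, ‖dataToFeatures μ hμ (u j)‖ ^ 2 =
      ∑ i : Fin d, singularValue (dataToFeatures μ hμ) i ^ 2 := by
  have hA := isCompactOperator_dataToFeatures μ hμ
  obtain ⟨v, hv, -⟩ := exists_isTopRightSingularVectors hA d
    (natCast_le_rank_of_linearIndependent hu.linearIndependent)
  -- Compared with the flat of top right singular vectors, `L` has two nonnegative excesses: its
  -- squared distance from the center of mass and its defect in Ky Fan's inequality. Minimality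
  -- makes both vanish.
  have hle : rmsDist μ L ≤ _ :=
    hL.2 (mk'_mem_affineGrassmannian hv.1.linearIndependent (centerOfMass μ))
  rw [rmsDist_mk'_span μ hμ hv, rmsDist,
    Real.sqrt_le_sqrt_iff (tsum_nonneg fun _ => sq_nonneg _), integral_infDist_sq μ hμ hL.1.1 hu hspan,
    tsum_singularValue_sq_tail] at hle
  have hky := sum_norm_sq_apply_le_sum_singularValue_sq hA hu
  have hsq := sq_nonneg (Metric.infDist (centerOfMass μ) (L : Set H))
  refine ⟨?_, by linarith⟩
  have h0 : Metric.infDist (centerOfMass μ) (L : Set H) = 0 :=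
    pow_eq_zero_iff two_ne_zero |>.1 (by linarith)
  have hfin : FiniteDimensional ℝ L.direction := by
    rw [← hspan]; exact FiniteDimensional.span_of_finite ℝ (Set.finite_range u)
  have hcl : IsClosed (L : Set H) :=
    (AffineSubspace.isClosed_direction_iff L).1 (Submodule.closed_of_finiteDimensional _)
  exact (hcl.mem_iff_infDist_zero hL.1.1).2 h0

/-- A spectral gap makes the least squares flat unique. -/
theorem existsUnique_isLSFlat_of_gap {d : ℕ} (hd : (d : Cardinal) ≤ Module.rank ℝ H)
    (hgap : ∀ i : Fin d, singularValue (dataToFeatures μ hμ) d <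
      singularValue (dataToFeatures μ hμ) i) : ∃! L : AffineSubspace ℝ H, IsLSFlat μ d L := by
  obtain ⟨v, hv, hmax⟩ :=
    exists_isTopRightSingularVectors (isCompactOperator_dataToFeatures μ hμ) d hd
  refine ⟨_, isLSFlat_mk'_span μ hμ hv, fun L hL => ?_⟩
  obtain ⟨u, hu, hspan⟩ := exists_orthonormal_of_mem_affineGrassmannian hL.1
  obtain ⟨hc, hsum⟩ := hL.centerOfMass_mem_and_sum_eq μ hμ hu hspan
  rw [← hv.span_eq_of_sum_norm_sq_eq hmax hgap hu hsum, hspan, AffineSubspace.mk'_eq hc]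

/-- Without a spectral gap, the least squares flat is not unique. -/
theorem not_existsUnique_isLSFlat {k : ℕ} (hk : ((k + 1 : ℕ) : Cardinal) < Module.rank ℝ H)
    (heq : singularValue (dataToFeatures μ hμ) (k + 1) = singularValue (dataToFeatures μ hμ) k) :
    ¬ ∃! L : AffineSubspace ℝ H, IsLSFlat μ (k + 1) L := by
  intro huniq
  have hk2 : ((k + 2 : ℕ) : Cardinal) ≤ Module.rank ℝ H := by
    have := Order.succ_le_of_lt hk
    rw [Cardinal.succ_natCast] at this
    exact_mod_cast this
  obtain ⟨v, hv, -⟩ := exists_isTopRightSingularVectors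
    (isCompactOperator_dataToFeatures μ hμ) (k + 2) hk2
  -- Of `k + 2` top vectors, `h1` omits the one of index `k + 1` and `h2` the one of index `k`. Both
  -- choices are top families because these two singular values coincide.
  have hsub : ∀ {e : Fin (k + 1) → Fin (k + 2)}, Function.Injective e →
      (∀ i, singularValue (dataToFeatures μ hμ) (e i) = singularValue (dataToFeatures μ hμ) i) →
      IsTopRightSingularVectors (dataToFeatures μ hμ) (v ∘ e) := fun he hs =>
    ⟨hv.1.comp _ he, fun i => by rw [Function.comp_apply, hv.2, hs]⟩
  have h1 := isLSFlat_mk'_span μ hμ (hsub (e := Fin.castSucc) (Fin.castSucc_injective _)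
    fun i => by rw [Fin.val_castSucc])
  have h2 := isLSFlat_mk'_span μ hμ (hsub (e := (Fin.last k).castSucc.succAbove)
    Fin.succAbove_right_injective fun i => by
      induction i using Fin.lastCases with
      | last => rw [Fin.succAbove_castSucc_self]; simpa using heq
      | cast i =>
        rw [Fin.succAbove_of_castSucc_lt _ _ (Fin.castSucc_lt_castSucc_iff.2
          (Fin.castSucc_lt_last i)), Fin.val_castSucc])
  have h3 := congrArg AffineSubspace.direction (huniq.unique h1 h2)
  rw [AffineSubspace.direction_mk', AffineSubspace.direction_mk'] at h3
  -- The vector of index `k` lies in the first span and is orthogonal to the second, so equal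
  -- directions would make it zero.
  have h4 : v (Fin.last k).castSucc ∈ Submodule.span ℝ
      (Set.range (v ∘ (Fin.last k).castSucc.succAbove)) := by
    rw [← h3]
    exact Submodule.subset_span ⟨Fin.last k, rfl⟩
  have h5 : v (Fin.last k).castSucc ∈ (Submodule.span ℝ
      (Set.range (v ∘ (Fin.last k).castSucc.succAbove)))ᗮ :=
    mem_orthogonal_span_range.2 fun i => hv.1.2 (Fin.succAbove_ne _ i)
  have h6 : v (Fin.last k).castSucc = 0 := by
    rw [← inner_self_eq_zero (𝕜 := ℝ)]
    exact (Submodule.mem_orthogonal _ _).1 h5 _ h4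
  exact hv.1.ne_zero _ h6

end LeastSquares

end LeastSquaresFlats

theorem mainTheorem5 {H : Type*} [NormedAddCommGroup H] [InnerProductSpace ℝ H] [CompleteSpace H]
    [TopologicalSpace.SeparableSpace H] [MeasurableSpace H] [BorelSpace H]
    (μ : Measure H) [IsProbabilityMeasure μ] (hμ : Bornology.IsBounded μ.support)
    (d : ℕ) (hd : (d : Cardinal) ≤ Module.rank ℝ H) :
    -- a least squares `d`-flat exists
    (∃ L : AffineSubspace ℝ H, IsLSFlat μ d L) ∧
    -- top right singular vectors exist, and each choice of them gives a least squares `d`-flat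
    (∃ v : Fin d → H, IsTopRightSingularVectors (dataToFeatures μ hμ) v) ∧
    (∀ v : Fin d → H, IsTopRightSingularVectors (dataToFeatures μ hμ) v →
      IsLSFlat μ d
        (AffineSubspace.mk' (centerOfMass μ) (Submodule.span ℝ (Set.range v)))) ∧
    -- uniqueness: `σ_d > σ_{d+1}`, where `singularValue _ n` is `σ_{n+1}`
    (1 ≤ d → (d : Cardinal) < Module.rank ℝ H →
      ((∃! L : AffineSubspace ℝ H, IsLSFlat μ d L) ↔
        singularValue (dataToFeatures μ hμ) d < singularValue (dataToFeatures μ hμ) (d - 1))) ∧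
    (d = 0 ∨ (d : Cardinal) = Module.rank ℝ H → ∃! L : AffineSubspace ℝ H, IsLSFlat μ d L) ∧
    -- the least squares error
    Summable (fun i : ℕ => singularValue (dataToFeatures μ hμ) (d + i) ^ 2) ∧
    lsError μ d = √(∑' i : ℕ, singularValue (dataToFeatures μ hμ) (d + i) ^ 2) := by
  obtain ⟨v, hv, -⟩ :=
    exists_isTopRightSingularVectors (isCompactOperator_dataToFeatures μ hμ) d hd
  refine ⟨⟨_, isLSFlat_mk'_span μ hμ hv⟩, ⟨v, hv⟩, fun w hw => isLSFlat_mk'_span μ hμ hw, ?_, ?_,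
    ?_, lsError_eq_sqrt_tail μ hμ hd⟩
  · intro h1 hlt
    obtain ⟨k, rfl⟩ : ∃ k, d = k + 1 := ⟨d - 1, by omega⟩
    rw [Nat.add_sub_cancel]
    have hanti := singularValue_antitone (dataToFeatures μ hμ)
    constructor
    · intro huniq
      by_contra hge
      exact not_existsUnique_isLSFlat μ hμ hlt
        (le_antisymm (hanti k.le_succ) (not_lt.1 hge)) huniq
    · intro hgap
      exact existsUnique_isLSFlat_of_gap μ hμ hd
        fun i => hgap.trans_le (hanti (Nat.lt_succ_iff.1 i.2))
  -- For `d = 0` the gap condition is vacuous. In full dimension the gap may fail, as the last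
  -- singular value can be `0`, but the whole space is the only `d`-flat.
  · rintro (rfl | htop)
    · exact existsUnique_isLSFlat_of_gap μ hμ hd fun i => i.elim0
    · refine ⟨_, isLSFlat_mk'_span μ hμ hv, fun L hL => ?_⟩
      rw [eq_top_of_mem_affineGrassmannian htop hL.1,
        eq_top_of_mem_affineGrassmannian htop (isLSFlat_mk'_span μ hμ hv).1]
  · have h := (summable_nat_add_iff d).2 (hasSum_singularValue_sq μ hμ).summable
    simpa only [add_comm] using h
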